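/- Let $\mathsf{X}$ be a Polish space with its Borel $\sigma$-algebra, let $K$ be a Markov transition kernel on $\mathsf{X}$, and let $\varpi$ be a probability measure on $\mathsf{X}$ with respect to which $K$ is reversible, i.e. $\int_A K(x,B)\,\varpi(\mathrm{d}x)=\int_B K(x,A)\,\varpi(\mathrm{d}x)$ for all measurable $A,B$ (so that $\varpi K=\varpi$). Let $\mathcal{F}'$ be the set of probability measures $\mu\ll\varpi$ with $\int_{\mathsf X}(\mathrm{d}\mu/\mathrm{d}\varpi)^2\,\mathrm{d}\varpi<\infty$, and for $\mu,\nu\in\mathcal{F}'$ let \[ \|\mu-\nu\|_2=\sup\Big\{\Big|\int f\,\mathrm{d}\mu-\int f\,\mathrm{d}\nu\Big| : f:\mathsf{X}\to\mathbb{R}\text{ measurable},\ \int f^2\,\mathrm{d}\varpi=1\Big\}. \] Let $\mu K^t$ denote the law after $t$ steps of the chain started from $\mu$ (so $\mu K^0=\mu$). Let $L^2_0(\varpi)$ be the space of $f\in L^2(\varpi)$ with $\int f\,\mathrm{d}\varpi=0$, and let $\|K\|_2$ be the operator norm of the bounded linear operator $f\mapsto Kf$, $Kf(x)=\int f(x')\,K(x,\mathrm{d}x')$,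 on $L^2_0(\varpi)$ with the $L^2(\varpi)$ norm. Suppose that there exist a function $C:\mathcal{F}'\to[0,\infty)$ and a constant $\rho\in[0,1)$ such that \[ \|\mu K^t-\varpi\|_2\le C(\mu)\,\rho^t\qquad\text{for all }\mu\in\mathcal{F}'\text{ and all integers }t\ge 0 . \] Then $\|K\|_2\le\rho$. -/

import Mathlib

open MeasureTheory ProbabilityTheory
open scoped ENNReal NNReal

namespace MarkovL2

variable {X : Type*} [MeasurableSpace X]

/-- The class of initial laws: probability measures `μ ≪ π` whose density `dμ/dπ` is
square-integrable with respect to `π`. -/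
def sqIntegrableLaws (π : Measure X) : Set (Measure X) :=
  {μ | IsProbabilityMeasure μ ∧ μ ≪ π ∧ ∫⁻ x, μ.rnDeriv π x ^ 2 ∂π < ∞}

/-- Real measurable functions with `∫ f² dπ = 1`.  (The Bochner integral of a function that is
not integrable is `0`, so the equation forces `f²` to be integrable.) -/
def unitTestFunctions (π : Measure X) : Set (X → ℝ) :=
  {f | Measurable f ∧ ∫ x, f x ^ 2 ∂π = 1}

/-- The `L²(π)` distance `‖μ - ν‖₂ = sup_f |μ f - ν f|`, over measurable `f` with `∫ f² dπ = 1`,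
as an extended nonnegative number. -/
noncomputable def l2Dist (π μ ν : Measure X) : ℝ≥0∞ :=
  ⨆ f ∈ unitTestFunctions π, ENNReal.ofReal |∫ x, f x ∂μ - ∫ x, f x ∂ν|

/-- `L²₀(π)`: the elements of `L²(π)` with mean zero. -/
def L2zero (π : Measure X) [IsProbabilityMeasure π] : Submodule ℝ (Lp ℝ 2 π) where
  carrier := {f | ∫ x, f x ∂π = 0}
  zero_mem' := by
    simp only [Set.mem_ofPred_eq]
    rw [integral_congr_ae (Lp.coeFn_zero ℝ 2 π)]
    simp
  add_mem' {f g} hf hg := by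
    simp only [Set.mem_ofPred_eq] at *
    rw [integral_congr_ae (Lp.coeFn_add f g)]
    simp only [Pi.add_apply]
    rw [integral_add ((Lp.memLp f).integrable one_le_two)
      ((Lp.memLp g).integrable one_le_two), hf, hg, add_zero]
  smul_mem' c f hf := by
    simp only [Set.mem_ofPred_eq] at *
    rw [integral_congr_ae (Lp.coeFn_smul c f)]
    simp only [Pi.smul_apply]
    rw [integral_smul, hf, smul_zero]

/-- `(K f)(x) = ∫ f(x') K(x, dx')`. -/
noncomputable def act (K : Kernel X X) (f : X → ℝ) : X → ℝ := fun x => ∫ y, f y ∂(K x)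

section

variable {K : Kernel X X} {π : Measure X}

theorem ae_ae_of_invariant (hK : K.Invariant π) {p : X → Prop} (h : ∀ᵐ x ∂π, p x) :
    ∀ᵐ x ∂π, ∀ᵐ y ∂(K x), p y := by
  rw [← hK.def] at h
  exact Measure.ae_ae_of_ae_comp h

theorem act_congr (hK : K.Invariant π) {f g : X → ℝ} (h : f =ᵐ[π] g) :
    act K f =ᵐ[π] act K g := by
  filter_upwards [ae_ae_of_invariant hK h] with x hx
  exact integral_congr_ae hx

theorem ae_integrable (hK : K.Invariant π) {f : X → ℝ} (hf : Integrable f π) :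
    ∀ᵐ x ∂π, Integrable f (K x) := by
  rw [← hK.def] at hf
  exact ((Measure.integrable_comp_iff hf.1).1 hf).1

theorem integral_act (hK : K.Invariant π) {f : X → ℝ} (hf : Integrable f π) :
    ∫ x, act K f x ∂π = ∫ x, f x ∂π := by
  have h : Integrable f (π.bind K) := by rw [hK.def]; exact hf
  rw [Measure.comp_eq_comp_const_apply] at h
  have h2 := Kernel.integral_comp h
  rw [← Measure.comp_eq_comp_const_apply, hK.def] at h2
  simpa [act] using h2.symm

theorem eLpNorm_act_le [IsMarkovKernel K] (hK : K.Invariant π) {f : X → ℝ}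
    (hf : StronglyMeasurable f) : eLpNorm (act K f) 2 π ≤ eLpNorm f 2 π := by
  have key : ∀ x, ‖act K f x‖ₑ ^ (2 : ℝ) ≤ ∫⁻ y, ‖f y‖ₑ ^ (2 : ℝ) ∂(K x) := by
    intro x
    have h1 : ‖act K f x‖ₑ ≤ eLpNorm f 1 (K x) := by
      rw [eLpNorm_one_eq_lintegral_enorm]
      exact enorm_integral_le_lintegral_enorm _
    have h2 : eLpNorm f 1 (K x) ≤ eLpNorm f 2 (K x) :=
      eLpNorm_le_eLpNorm_of_exponent_le one_le_two hf.aestronglyMeasurable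
    calc ‖act K f x‖ₑ ^ (2 : ℝ) ≤ eLpNorm f 2 (K x) ^ (2 : ℝ) := by
          gcongr; exact h1.trans h2
      _ = _ := by
          rw [eLpNorm_eq_lintegral_rpow_enorm_toReal two_ne_zero ENNReal.ofNat_ne_top,
            ← ENNReal.rpow_mul]
          simp
  rw [eLpNorm_eq_lintegral_rpow_enorm_toReal two_ne_zero ENNReal.ofNat_ne_top,
    eLpNorm_eq_lintegral_rpow_enorm_toReal two_ne_zero ENNReal.ofNat_ne_top]
  simp only [ENNReal.toReal_ofNat]
  gcongr ?_ ^ _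
  calc ∫⁻ x, ‖act K f x‖ₑ ^ (2 : ℝ) ∂π ≤ ∫⁻ x, ∫⁻ y, ‖f y‖ₑ ^ (2 : ℝ) ∂(K x) ∂π :=
        lintegral_mono key
    _ = ∫⁻ y, ‖f y‖ₑ ^ (2 : ℝ) ∂(π.bind K) := by
        rw [Measure.lintegral_bind K.aemeasurable (hf.enorm.pow_const _).aemeasurable]
    _ = _ := by rw [hK.def]

theorem memLp_act [IsMarkovKernel K] (hK : K.Invariant π) (f : Lp ℝ 2 π) :
    MemLp (act K f) 2 π :=
  ⟨(Lp.stronglyMeasurable f).integral_kernel.aestronglyMeasurable,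
    (eLpNorm_act_le hK (Lp.stronglyMeasurable f)).trans_lt (Lp.memLp f).eLpNorm_lt_top⟩

end

/-- The Markov operator `f ↦ K f` on `L²₀(π)` of a Markov kernel `K` with stationary law `π`. -/
noncomputable def markovOperator (K : Kernel X X) [IsMarkovKernel K] (π : Measure X)
    [IsProbabilityMeasure π] (hK : K.Invariant π) : L2zero π →L[ℝ] L2zero π :=
  LinearMap.mkContinuous
    { toFun := fun f => ⟨(memLp_act hK (f : Lp ℝ 2 π)).toLp (act K (f : Lp ℝ 2 π)), by
        change ∫ x, (memLp_act hK (f : Lp ℝ 2 π)).toLp (act K (f : Lp ℝ 2 π)) x ∂π = 0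
        rw [integral_congr_ae (MemLp.coeFn_toLp _),
          integral_act hK ((Lp.memLp (f : Lp ℝ 2 π)).integrable one_le_two)]
        exact f.2⟩
      map_add' := fun f g => by
        apply Subtype.ext
        refine MemLp.toLp_congr (memLp_act hK _) ((memLp_act hK _).add (memLp_act hK _)) ?_
        have hf := ae_integrable hK ((Lp.memLp (f : Lp ℝ 2 π)).integrable one_le_two)
        have hg := ae_integrable hK ((Lp.memLp (g : Lp ℝ 2 π)).integrable one_le_two)
        refine (act_congr hK (Lp.coeFn_add (f : Lp ℝ 2 π) (g : Lp ℝ 2 π))).trans ?_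
        filter_upwards [hf, hg] with x h1 h2
        exact integral_add h1 h2
      map_smul' := fun c f => by
        apply Subtype.ext
        refine MemLp.toLp_congr (memLp_act hK _) ((memLp_act hK _).const_smul c) ?_
        refine (act_congr hK (Lp.coeFn_smul c (f : Lp ℝ 2 π))).trans ?_
        filter_upwards with x
        exact integral_smul c _ }
    1 (fun f => by
      rw [one_mul]
      change ‖(memLp_act hK (f : Lp ℝ 2 π)).toLp (act K (f : Lp ℝ 2 π))‖ ≤ ‖(f : Lp ℝ 2 π)‖
      rw [Lp.norm_toLp, Lp.norm_def]
      exact ENNReal.toReal_mono (Lp.memLp (f : Lp ℝ 2 π)).eLpNorm_ne_top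
        (eLpNorm_act_le hK (Lp.stronglyMeasurable (f : Lp ℝ 2 π))))

end MarkovL2

/-!
Reversibility makes the Markov operator `T` on `L²₀(π)` symmetric, so
`‖T ^ m f‖² = |⟪f, T ^ (2 * m) f⟫|`, and repeated squaring gives
`‖T f‖ ^ 2 ^ (n + 1) ≤ |⟪f, T ^ 2 ^ (n + 1) f⟫|` for a unit vector `f`. A bound
`|⟪f, T ^ m f⟫| ≤ C * ρ ^ m`, even with `C` depending on `f`, therefore forces `‖T f‖ ≤ ρ`.

Such a bound comes from the convergence of the chain: if `g ≥ 0` in `L²(π)` has integral `1`, then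
`g dπ` is an admissible initial law, and `∫ g K^t f dπ` is the integral of `f` against the law after
`t` steps, which is to be compared with `∫ f dπ = 0`. Take for `g` the normalized positive and
negative parts of `f`.
-/

namespace MarkovL2

variable {X : Type*} [MeasurableSpace X]

section PowerGrowth

open Filter Asymptotics

theorem le_of_frequently_pow_le_mul_pow {x ρ C : ℝ} (hρ : 0 ≤ ρ)
    (h : ∃ᶠ n : ℕ in atTop, x ^ n ≤ C * ρ ^ n) : x ≤ ρ := by
  by_contra! hlt
  have hx : 0 < x := hρ.trans_lt hlt
  have hlittle : (fun n : ℕ ↦ C * ρ ^ n) =o[atTop] fun n ↦ x ^ n :=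
    (isLittleO_pow_pow_of_lt_left hρ hlt).const_mul_left C
  obtain ⟨n, hle, hhalf⟩ := (h.and_eventually (hlittle.def one_half_pos)).exists
  rw [Real.norm_of_nonneg (by positivity : 0 ≤ x ^ n)] at hhalf
  linarith [Real.le_norm_self (C * ρ ^ n), pow_pos hx n]

end PowerGrowth

section SymmetricOperator

open Filter

variable {𝕜 H : Type*} [RCLike 𝕜] [NormedAddCommGroup H] [InnerProductSpace 𝕜 H]
  {T : H →ₗ[𝕜] H}

theorem sq_norm_pow_apply_eq_norm_inner (hT : T.IsSymmetric) (f : H) (n : ℕ) :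
    ‖(T ^ n) f‖ ^ 2 = ‖inner 𝕜 f ((T ^ (2 * n)) f)‖ := by
  rw [two_mul, pow_add, Module.End.mul_apply, ← hT.pow n, inner_self_eq_norm_sq_to_K, norm_pow,
    RCLike.norm_ofReal, abs_norm]

theorem norm_apply_pow_two_pow_le_norm_inner (hT : T.IsSymmetric) {f : H} (hf : ‖f‖ ≤ 1) (n : ℕ) :
    ‖T f‖ ^ 2 ^ (n + 1) ≤ ‖inner 𝕜 f ((T ^ 2 ^ (n + 1)) f)‖ := by
  induction n with
  | zero => simpa using (sq_norm_pow_apply_eq_norm_inner hT f 1).le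
  | succ n ih =>
    calc ‖T f‖ ^ 2 ^ (n + 2) = (‖T f‖ ^ 2 ^ (n + 1)) ^ 2 := by rw [pow_succ 2 (n + 1), pow_mul]
      _ ≤ ‖inner 𝕜 f ((T ^ 2 ^ (n + 1)) f)‖ ^ 2 := by gcongr
      _ ≤ ‖(T ^ 2 ^ (n + 1)) f‖ ^ 2 := by
        gcongr
        exact (norm_inner_le_norm _ _).trans (mul_le_of_le_one_left (norm_nonneg _) hf)
      _ = ‖inner 𝕜 f ((T ^ 2 ^ (n + 2)) f)‖ := by
        rw [sq_norm_pow_apply_eq_norm_inner hT, pow_succ' 2 (n + 1)]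

theorem norm_apply_le_of_norm_inner_pow_le (hT : T.IsSymmetric) {f : H} (hf : ‖f‖ ≤ 1) {C ρ : ℝ}
    (hρ : 0 ≤ ρ) (h : ∀ n : ℕ, ‖inner 𝕜 f ((T ^ n) f)‖ ≤ C * ρ ^ n) : ‖T f‖ ≤ ρ := by
  have htop : Tendsto (fun n : ℕ ↦ 2 ^ (n + 1)) atTop atTop :=
    (tendsto_pow_atTop_atTop_of_one_lt one_lt_two).comp (tendsto_add_atTop_nat 1)
  refine le_of_frequently_pow_le_mul_pow (C := C) hρ (htop.frequently (.of_forall fun n ↦ ?_))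
  exact (norm_apply_pow_two_pow_le_norm_inner hT hf n).trans (h _)

theorem opNorm_le_of_forall_norm_inner_pow_le {T : H →L[𝕜] H}
    (hT : (T : H →ₗ[𝕜] H).IsSymmetric) {ρ : ℝ} (hρ : 0 ≤ ρ)
    (h : ∀ f, ‖f‖ = 1 → ∃ C : ℝ, ∀ n : ℕ, ‖inner 𝕜 f ((T ^ n) f)‖ ≤ C * ρ ^ n) : ‖T‖ ≤ ρ := by
  refine ContinuousLinearMap.opNorm_le_of_unit_norm hρ fun f hf ↦ ?_
  obtain ⟨C, hC⟩ := h f hf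
  refine norm_apply_le_of_norm_inner_pow_le (C := C) hT hf.le hρ fun n ↦ ?_
  rw [← ContinuousLinearMap.toLinearMap_pow]
  exact hC n

end SymmetricOperator

variable {K L : Kernel X X} {π : Measure X} {f g : X → ℝ}

section Action

theorem integral_bind_eq_integral_act {μ : Measure X} (hf : Integrable f (μ.bind K)) :
    ∫ x, f x ∂(μ.bind K) = ∫ x, act K f x ∂μ := by
  rw [Measure.comp_eq_comp_const_apply] at hf ⊢
  exact Kernel.integral_comp hf

theorem memLp_act_of_memLp [IsMarkovKernel K] (hK : K.Invariant π) (hf : MemLp f 2 π) :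
    MemLp (act K f) 2 π :=
  (memLp_congr_ae (act_congr hK hf.coeFn_toLp)).1 (memLp_act hK (hf.toLp f))

theorem act_id (hf : StronglyMeasurable f) : act Kernel.id f = f := by
  ext x
  rw [act, Kernel.id_apply, integral_dirac' _ _ hf]

theorem act_comp_ae_eq (hKL : (K ∘ₖ L).Invariant π) (hf : Integrable f π) :
    act (K ∘ₖ L) f =ᵐ[π] act L (act K f) := by
  filter_upwards [ae_integrable hKL hf] with x hx
  exact Kernel.integral_comp hx

end Action

section Reversible

theorem map_swap_compProd_of_isReversible [IsFiniteKernel K] [IsFiniteMeasure π]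
    (hrev : K.IsReversible π) : (π ⊗ₘ K).map Prod.swap = π ⊗ₘ K := by
  refine Measure.ext_prod fun {s t} hs ht ↦ ?_
  rw [Measure.map_apply measurable_swap (hs.prod ht), Set.preimage_swap_prod,
    Measure.compProd_apply_prod ht hs, Measure.compProd_apply_prod hs ht]
  exact hrev ht hs

theorem integral_mul_act_eq_integral_compProd [IsMarkovKernel K] [SFinite π] {p q : ℝ≥0∞}
    [p.HolderConjugate q] (hK : K.Invariant π) (hf : MemLp f p π) (hg : MemLp g q π) :
    ∫ x, f x * act K g x ∂π = ∫ z, f z.1 * g z.2 ∂(π ⊗ₘ K) := by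
  have hfst : MeasurePreserving Prod.fst (π ⊗ₘ K) π := ⟨measurable_fst, Measure.fst_compProd π K⟩
  have hsnd : MeasurePreserving Prod.snd (π ⊗ₘ K) π :=
    ⟨measurable_snd, (Measure.snd_compProd π K).trans hK.def⟩
  have hint : Integrable (fun z : X × X ↦ f z.1 * g z.2) (π ⊗ₘ K) :=
    (hf.comp_measurePreserving hfst).integrable_mul (hg.comp_measurePreserving hsnd)
  rw [Measure.integral_compProd hint]
  simp only [act, integral_const_mul]

theorem integral_mul_act_comm [IsMarkovKernel K] [IsFiniteMeasure π] {p q : ℝ≥0∞}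
    [p.HolderConjugate q] (hrev : K.IsReversible π) (hf : MemLp f p π) (hg : MemLp g q π) :
    ∫ x, f x * act K g x ∂π = ∫ x, g x * act K f x ∂π := by
  have hswap : MeasurePreserving MeasurableEquiv.prodComm (π ⊗ₘ K) (π ⊗ₘ K) :=
    ⟨measurable_swap, map_swap_compProd_of_isReversible hrev⟩
  rw [integral_mul_act_eq_integral_compProd hrev.invariant hf hg,
    integral_mul_act_eq_integral_compProd hrev.invariant hg hf,
    ← hswap.integral_comp']
  exact integral_congr_ae (.of_forall fun z ↦ mul_comm _ _)

end Reversible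

section MarkovOperator

variable [IsMarkovKernel K] [IsMarkovKernel L] [IsProbabilityMeasure π]

theorem coeFn_markovOperator (hK : K.Invariant π) (f : L2zero π) :
    ((markovOperator K π hK f : Lp ℝ 2 π) : X → ℝ) =ᵐ[π] act K (f : Lp ℝ 2 π) :=
  (memLp_act hK (f : Lp ℝ 2 π)).coeFn_toLp

theorem inner_L2zero_eq_integral_mul (f g : L2zero π) :
    inner ℝ f g = ∫ x, (f : Lp ℝ 2 π) x * (g : Lp ℝ 2 π) x ∂π := by
  simp only [Submodule.coe_inner, L2.inner_def, RCLike.inner_apply, conj_trivial, mul_comm]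

theorem inner_markovOperator_right (hK : K.Invariant π) (f g : L2zero π) :
    inner ℝ f (markovOperator K π hK g)
      = ∫ x, (f : Lp ℝ 2 π) x * act K (g : Lp ℝ 2 π) x ∂π := by
  rw [inner_L2zero_eq_integral_mul]
  exact integral_congr_ae ((coeFn_markovOperator hK g).mono fun x hx ↦ by simp only [hx])

theorem isSymmetric_markovOperator (hrev : K.IsReversible π) :
    (markovOperator K π hrev.invariant : L2zero π →ₗ[ℝ] L2zero π).IsSymmetric := by
  intro f g
  rw [ContinuousLinearMap.coe_coe, real_inner_comm, inner_markovOperator_right,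
    inner_markovOperator_right]
  exact integral_mul_act_comm hrev (Lp.memLp _) (Lp.memLp _)

theorem markovOperator_id (hid : Kernel.id.Invariant π) : markovOperator Kernel.id π hid = 1 := by
  ext1 f
  refine Subtype.ext (Lp.ext ((coeFn_markovOperator hid f).trans ?_))
  rw [act_id (Lp.stronglyMeasurable _), one_apply_eq_self]

theorem markovOperator_comp (hK : K.Invariant π) (hL : L.Invariant π) :
    markovOperator (K ∘ₖ L) π (hK.comp hL) = markovOperator L π hL * markovOperator K π hK := by
  ext1 f
  refine Subtype.ext (Lp.ext ?_)
  calc ((markovOperator (K ∘ₖ L) π (hK.comp hL) f : Lp ℝ 2 π) : X → ℝ)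
      =ᵐ[π] act (K ∘ₖ L) (f : Lp ℝ 2 π) := coeFn_markovOperator _ f
    _ =ᵐ[π] act L (act K (f : Lp ℝ 2 π)) :=
      act_comp_ae_eq (hK.comp hL) ((Lp.memLp _).integrable one_le_two)
    _ =ᵐ[π] act L (markovOperator K π hK f : Lp ℝ 2 π) :=
      act_congr hL (coeFn_markovOperator hK f).symm
    _ =ᵐ[π] (markovOperator L π hL (markovOperator K π hK f) : Lp ℝ 2 π) :=
      (coeFn_markovOperator hL _).symm

end MarkovOperator

section Powers

instance isMarkovKernel_pow [IsMarkovKernel K] (t : ℕ) : IsMarkovKernel (K ^ t : Kernel X X) := by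
  induction t with
  | zero => exact inferInstanceAs (IsMarkovKernel Kernel.id)
  | succ t ih =>
    rw [pow_succ]
    exact inferInstanceAs (IsMarkovKernel ((K ^ t : Kernel X X) ∘ₖ K))

theorem invariant_pow (hK : K.Invariant π) (t : ℕ) : (K ^ t : Kernel X X).Invariant π := by
  induction t with
  | zero => exact Measure.id_comp
  | succ t ih =>
    rw [pow_succ]
    exact ih.comp hK

theorem markovOperator_pow [IsMarkovKernel K] [IsProbabilityMeasure π] (hK : K.Invariant π)
    (t : ℕ) : markovOperator (K ^ t) π (invariant_pow hK t) = markovOperator K π hK ^ t := by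
  induction t with
  | zero => exact markovOperator_id _
  | succ t ih =>
    rw [pow_succ' (markovOperator K π hK), ← ih]
    exact markovOperator_comp (invariant_pow hK t) hK

end Powers

section Densities

theorem withDensity_ofReal_mem_sqIntegrableLaws [SigmaFinite π] (hg : MemLp g 2 π)
    (hg0 : 0 ≤ᵐ[π] g) (hg1 : ∫ x, g x ∂π = 1) :
    π.withDensity (fun x ↦ ENNReal.ofReal (g x)) ∈ sqIntegrableLaws π := by
  have hmass : ∫⁻ x, ENNReal.ofReal (g x) ∂π = 1 := by
    have hint : Integrable g π := .of_integral_ne_zero (hg1 ▸ one_ne_zero)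
    rw [← ofReal_integral_eq_lintegral_ofReal hint hg0, hg1, ENNReal.ofReal_one]
  refine ⟨⟨by rwa [withDensity_apply _ .univ, Measure.restrict_univ]⟩,
    withDensity_absolutelyContinuous _ _, ?_⟩
  calc ∫⁻ x, (π.withDensity fun x ↦ ENNReal.ofReal (g x)).rnDeriv π x ^ 2 ∂π
      = ∫⁻ x, ENNReal.ofReal (g x ^ 2) ∂π := by
        refine lintegral_congr_ae ?_
        filter_upwards [Measure.rnDeriv_withDensity₀ π hg.1.aemeasurable.ennreal_ofReal, hg0]
          with x hx hgx
        rw [hx, ENNReal.ofReal_pow hgx]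
    _ < ∞ := hg.integrable_sq.lintegral_lt_top

theorem integrable_withDensity_ofReal {p q : ℝ≥0∞} [p.HolderConjugate q] (hg : MemLp g p π)
    (hg0 : 0 ≤ᵐ[π] g) (hf : MemLp f q π) :
    Integrable f (π.withDensity fun x ↦ ENNReal.ofReal (g x)) := by
  rw [integrable_withDensity_iff_integrable_smul₀' hg.1.aemeasurable.ennreal_ofReal
    (.of_forall fun _ ↦ ENNReal.ofReal_lt_top)]
  refine (hg.integrable_mul hf).congr ?_
  filter_upwards [hg0] with x hx
  rw [ENNReal.toReal_ofReal hx, Pi.mul_apply, smul_eq_mul]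

theorem integral_withDensity_ofReal (hg : AEMeasurable g π) (hg0 : 0 ≤ᵐ[π] g) :
    ∫ x, f x ∂(π.withDensity fun x ↦ ENNReal.ofReal (g x)) = ∫ x, g x * f x ∂π := by
  rw [integral_withDensity_eq_integral_toReal_smul₀ hg.ennreal_ofReal
    (.of_forall fun _ ↦ ENNReal.ofReal_lt_top)]
  refine integral_congr_ae ?_
  filter_upwards [hg0] with x hx
  rw [ENNReal.toReal_ofReal hx, smul_eq_mul]

theorem integral_bind_withDensity_ofReal [IsMarkovKernel K] [IsFiniteMeasure π]
    (hK : K.Invariant π) (hg : MemLp g 2 π) (hg0 : 0 ≤ᵐ[π] g) (hf : MemLp f 2 π) :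
    ∫ x, f x ∂((π.withDensity fun x ↦ ENNReal.ofReal (g x)).bind K)
      = ∫ x, g x * act K f x ∂π := by
  set μ := π.withDensity fun x ↦ ENNReal.ofReal (g x)
  have hμ : μ ≪ π := withDensity_absolutelyContinuous _ _
  have hμK : μ.bind K ≪ π := by
    simpa only [hK.def] using hμ.comp_right K
  have hint : Integrable f (μ.bind K) :=
    (Measure.integrable_comp_iff (hf.1.mono_ac hμK)).2
      ⟨hμ.ae_le (ae_integrable hK (hf.integrable one_le_two)),
        integrable_withDensity_ofReal hg hg0 (memLp_act_of_memLp hK hf.norm)⟩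
  rw [integral_bind_eq_integral_act hint, integral_withDensity_ofReal hg.1.aemeasurable hg0]

end Densities

section Convergence

/-- Geometric ergodicity of `K` in `L²(π)` at rate `ρ`: from every square-integrable initial law the
chain converges to `π` in `L²(π)` distance at a rate `O(ρ ^ t)`. The implied constant may depend on
the initial law in an arbitrary way. -/
def IsL2GeometricallyErgodic (K : Kernel X X) (π : Measure X) (ρ : ℝ) : Prop :=
  ∀ μ ∈ sqIntegrableLaws π, ∃ C : ℝ≥0, ∀ t : ℕ,
    l2Dist π (μ.bind (K ^ t : Kernel X X)) π ≤ ENNReal.ofReal (C * ρ ^ t)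

theorem ofReal_abs_integral_sub_le_l2Dist (μ ν : Measure X) (hf : f ∈ unitTestFunctions π) :
    ENNReal.ofReal |∫ x, f x ∂μ - ∫ x, f x ∂ν| ≤ l2Dist π μ ν :=
  le_iSup₂ (f := fun (f : X → ℝ) (_ : f ∈ unitTestFunctions π) ↦
    ENNReal.ofReal |∫ x, f x ∂μ - ∫ x, f x ∂ν|) f hf

theorem coeFn_mem_unitTestFunctions {f : Lp ℝ 2 π} (hf : ‖f‖ = 1) :
    (f : X → ℝ) ∈ unitTestFunctions π := by
  refine ⟨(Lp.stronglyMeasurable f).measurable, ?_⟩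
  have hinner : inner ℝ f f = (1 : ℝ) := by rw [real_inner_self_eq_norm_sq, hf, one_pow]
  simpa only [L2.inner_def, real_inner_self_eq_norm_sq, Real.norm_eq_abs, sq_abs] using hinner

variable [IsMarkovKernel K] [IsProbabilityMeasure π] {ρ : ℝ}

theorem exists_abs_integral_mul_act_pow_le_of_integral_eq_one (hK : K.Invariant π) (hρ : 0 ≤ ρ)
    (herg : IsL2GeometricallyErgodic K π ρ) {f : L2zero π} (hf : ‖f‖ = 1) (hg : MemLp g 2 π)
    (hg0 : 0 ≤ᵐ[π] g) (hg1 : ∫ x, g x ∂π = 1) :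
    ∃ C : ℝ, ∀ t : ℕ, |∫ x, g x * act (K ^ t) (f : Lp ℝ 2 π) x ∂π| ≤ C * ρ ^ t := by
  obtain ⟨C, hC⟩ := herg _ (withDensity_ofReal_mem_sqIntegrableLaws hg hg0 hg1)
  refine ⟨C, fun t ↦ ?_⟩
  have hmean : ∫ x, (f : Lp ℝ 2 π) x ∂π = 0 := f.2
  have hunit : ((f : Lp ℝ 2 π) : X → ℝ) ∈ unitTestFunctions π := coeFn_mem_unitTestFunctions hf
  have hdist := (ofReal_abs_integral_sub_le_l2Dist _ π hunit).trans (hC t)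
  rwa [ENNReal.ofReal_le_ofReal_iff (by positivity), hmean, sub_zero,
    integral_bind_withDensity_ofReal (invariant_pow hK t) hg hg0 (Lp.memLp _)] at hdist

theorem exists_abs_integral_mul_act_pow_le_of_nonneg (hK : K.Invariant π) (hρ : 0 ≤ ρ)
    (herg : IsL2GeometricallyErgodic K π ρ) {f : L2zero π} (hf : ‖f‖ = 1) (hg : MemLp g 2 π)
    (hg0 : 0 ≤ᵐ[π] g) :
    ∃ C : ℝ, ∀ t : ℕ, |∫ x, g x * act (K ^ t) (f : Lp ℝ 2 π) x ∂π| ≤ C * ρ ^ t := by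
  set m := ∫ x, g x ∂π with hm
  have hm0 : 0 ≤ m := integral_nonneg_of_ae hg0
  rcases hm0.eq_or_lt with hzero | hpos
  · have hgz : g =ᵐ[π] 0 :=
      (integral_eq_zero_iff_of_nonneg_ae hg0 (hg.integrable one_le_two)).1 hzero.symm
    refine ⟨0, fun t ↦ ?_⟩
    rw [integral_eq_zero_of_ae (hgz.mono fun x hx ↦ by simp [hx]), abs_zero, zero_mul]
  · obtain ⟨C, hC⟩ := exists_abs_integral_mul_act_pow_le_of_integral_eq_one hK hρ herg hf
      (hg.const_mul m⁻¹) (hg0.mono fun x hx ↦ mul_nonneg (inv_nonneg.2 hm0) hx)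
      (by rw [integral_const_mul, ← hm, inv_mul_cancel₀ hpos.ne'])
    refine ⟨m * C, fun t ↦ ?_⟩
    have h := hC t
    simp only [mul_assoc] at h
    rwa [integral_const_mul, abs_mul, abs_of_pos (inv_pos.2 hpos), inv_mul_le_iff₀ hpos,
      ← mul_assoc] at h

theorem exists_abs_integral_mul_act_pow_le (hK : K.Invariant π) (hρ : 0 ≤ ρ)
    (herg : IsL2GeometricallyErgodic K π ρ) {f : L2zero π} (hf : ‖f‖ = 1) (hg : MemLp g 2 π) :
    ∃ C : ℝ, ∀ t : ℕ, |∫ x, g x * act (K ^ t) (f : Lp ℝ 2 π) x ∂π| ≤ C * ρ ^ t := by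
  obtain ⟨C, hC⟩ := exists_abs_integral_mul_act_pow_le_of_nonneg hK hρ herg hf hg.pos_part
    (.of_forall fun x ↦ le_max_right _ _)
  obtain ⟨D, hD⟩ := exists_abs_integral_mul_act_pow_le_of_nonneg hK hρ herg hf hg.neg_part
    (.of_forall fun x ↦ le_max_right _ _)
  refine ⟨C + D, fun t ↦ ?_⟩
  have hact : MemLp (act (K ^ t) (f : Lp ℝ 2 π)) 2 π := memLp_act (invariant_pow hK t) f
  have hsplit : ∫ x, g x * act (K ^ t) (f : Lp ℝ 2 π) x ∂π
      = ∫ x, max (g x) 0 * act (K ^ t) (f : Lp ℝ 2 π) x ∂π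
        - ∫ x, max (-g x) 0 * act (K ^ t) (f : Lp ℝ 2 π) x ∂π := by
    refine Eq.trans ?_
      (integral_sub (hg.pos_part.integrable_mul hact) (hg.neg_part.integrable_mul hact))
    simp only [← sub_mul, max_zero_sub_max_neg_zero_eq_self]
  rw [hsplit, add_mul]
  exact (abs_sub _ _).trans (add_le_add (hC t) (hD t))

end Convergence

end MarkovL2

open MarkovL2 in
theorem mainTheorem7_general {X : Type*} [MeasurableSpace X] {K : Kernel X X} [IsMarkovKernel K]
    {π : Measure X} [IsProbabilityMeasure π] (hrev : K.IsReversible π) {ρ : ℝ} (hρ : 0 ≤ ρ)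
    (herg : IsL2GeometricallyErgodic K π ρ) : ‖markovOperator K π hrev.invariant‖ ≤ ρ := by
  refine opNorm_le_of_forall_norm_inner_pow_le (isSymmetric_markovOperator hrev) hρ fun f hf ↦ ?_
  simp only [← markovOperator_pow, inner_markovOperator_right, Real.norm_eq_abs]
  exact exists_abs_integral_mul_act_pow_le hrev.invariant hρ herg hf (Lp.memLp _)

theorem mainTheorem7 {X : Type*} [TopologicalSpace X] [PolishSpace X] [MeasurableSpace X]
    [BorelSpace X] (K : Kernel X X) [IsMarkovKernel K] (π : Measure X) [IsProbabilityMeasure π]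
    (hrev : K.IsReversible π)
    (C : MarkovL2.sqIntegrableLaws π → ℝ≥0) (ρ : ℝ) (hρ₀ : 0 ≤ ρ) (hρ₁ : ρ < 1)
    (hconv : ∀ (μ : MarkovL2.sqIntegrableLaws π) (t : ℕ),
      MarkovL2.l2Dist π ((μ : Measure X).bind (K ^ t : Kernel X X)) π
        ≤ ENNReal.ofReal (C μ * ρ ^ t)) :
    ‖MarkovL2.markovOperator K π hrev.invariant‖ ≤ ρ :=
  mainTheorem7_general hrev hρ₀ fun μ hμ ↦ ⟨C ⟨μ, hμ⟩, hconv ⟨μ, hμ⟩⟩
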